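/- Let $\varphi = (\varphi_e)_{e\in\mathbb N}$ be any acceptable programming system for the partial computable functions $\mathbb N \rightharpoonup \mathbb N$ (that is, $(e,x)\mapsto\varphi_e(x)$ is partial computable, and for every partial computable $\psi(e,x)$ there is a total computable $f$ with $\varphi_{f(e)} = \psi(e,\cdot)$ for all $e$), and let $W_e = \mathrm{dom}(\varphi_e)$. A language is a computably enumerable set $L\subseteq\mathbb N$. A text is a function $T:\mathbb N\to\mathbb N\cup\{\#\}$; its content is $\mathrm{content}(T)=\mathrm{range}(T)\setminus\{\#\}$, it is a text for $L$ if $\mathrm{content}(T)=L$, and $T[i]$ denotes the finite sequence $T(0),\dots,T(i-1)$, whose content is defined in the same way. A learner is a partial computable function $h$ from finite sequences over $\mathbb N\cup\{\#\}$ to $\mathbb N$; its learning sequence on $T$ is $p(i)=h(T[i])$. For a learning sequence $p$ and a text $T$, each of the following conditions includes the requirement that $p$ is total: - $\mathbf{Ex}(p,T)$: there is $n_0$ such that for all $n\ge n_0$, $p(n)=p(n_0)$ and $W_{p(n_0)}=\mathrm{content}(T)$; - $\mathbf{WMon}(p,T)$ (weakly monotone): for all $i<j$, if $\mathrm{content}(T[j])\subseteq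 W_{p(i)}$ then $W_{p(i)}\subseteq W_{p(j)}$; - $\mathbf{SDec}(p,T)$ (strongly decisive): for all $i\le j\le k$, if $W_{p(i)}=W_{p(k)}$ then $p(j)=p(i)$. For $\delta\in\{\mathbf{WMon},\mathbf{SDec}\}$ let $[\mathbf{TxtG}\delta\mathbf{Ex}]$ be the set of all classes $\mathcal L$ of languages for which there is a single learner $h$ such that for every $L\in\mathcal L$ and every text $T$ for $L$, the learning sequence $p$ of $h$ on $T$ satisfies both $\delta(p,T)$ and $\mathbf{Ex}(p,T)$. Then $$[\mathbf{TxtGWMonEx}] \subsetneq [\mathbf{TxtGSDecEx}].$$ -/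

import Mathlib

namespace InductiveInference

/-- A programming system `φ` (with `φ e` the partial function computed by program `e`) is acceptable
if it is partial computable uniformly in the program, and every uniformly partial computable family
of functions can be computably translated into it. In particular every partial computable function
is some `φ e`. -/
def IsAcceptable (φ : ℕ → ℕ →. ℕ) : Prop :=
  Partrec₂ φ ∧
    ∀ ψ : ℕ → ℕ →. ℕ, Partrec₂ ψ → ∃ f : ℕ → ℕ, Computable f ∧ ∀ e, φ (f e) = ψ e

/-- `W φ e` is the computably enumerable set with index `e`: the domain of `φ e`. -/
def W (φ : ℕ → ℕ →. ℕ) (e : ℕ) : Set ℕ :=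
  (φ e).Dom

/-- A language is a computably enumerable set of natural numbers. -/
def IsLanguage (L : Set ℕ) : Prop :=
  REPred fun x => x ∈ L

/-- Finite sequences of data; `none` is the pause symbol. -/
abbrev DataSeq := List (Option ℕ)

/-- A text is a total function from `ℕ` to `ℕ` together with the pause symbol `none`. -/
abbrev Text := ℕ → Option ℕ

/-- The set of numbers occurring in a finite sequence. -/
def DataSeq.content (σ : DataSeq) : Set ℕ :=
  {x | some x ∈ σ}

/-- The set of numbers occurring in a text. -/
def Text.content (T : Text) : Set ℕ :=
  {x | ∃ n, T n = some x}

/-- The initial part `T 0, …, T (n - 1)` of a text. -/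
def Text.init (T : Text) (n : ℕ) : DataSeq :=
  (List.range n).map T

/-- The interaction operator `G`: the (possibly partial) learning sequence `i ↦ h (T[i])`. -/
def G (h : DataSeq →. ℕ) (T : Text) : ℕ →. ℕ :=
  fun i => h (T.init i)

/-- A learning restriction is a predicate on a learning sequence and a text. -/
abbrev Restriction := (ℕ →. ℕ) → Text → Prop

/-- Explanatory learning: `p` is total and converges to a single index of the content of `T`. -/
def Ex (φ : ℕ → ℕ →. ℕ) : Restriction := fun p T =>
  ∃ q : ℕ → ℕ, p = (q : ℕ →. ℕ) ∧
    ∃ n₀, ∀ n ≥ n₀, q n = q n₀ ∧ W φ (q n₀) = T.content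

/-- Weakly monotone: a conjecture may only be replaced by a superset while it is consistent. -/
def WMon (φ : ℕ → ℕ →. ℕ) : Restriction := fun p T =>
  ∃ q : ℕ → ℕ, p = (q : ℕ →. ℕ) ∧
    ∀ i j, i < j → (T.init j).content ⊆ W φ (q i) → W φ (q i) ⊆ W φ (q j)

/-- Strongly decisive: no semantic return to a syntactically abandoned conjecture. -/
def SDec (φ : ℕ → ℕ →. ℕ) : Restriction := fun p _ =>
  ∃ q : ℕ → ℕ, p = (q : ℕ →. ℕ) ∧
    ∀ i j k, i ≤ j → j ≤ k → W φ (q i) = W φ (q k) → q j = q i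

/-- The combination of two learning restrictions is their intersection. -/
def Restriction.both (δ δ' : Restriction) : Restriction := fun p T =>
  δ p T ∧ δ' p T

/-- The set of languages that the learner `h` learns by `G`-interaction with texts, subject to
the restriction `δ`. -/
def TxtG (δ : Restriction) (h : DataSeq →. ℕ) : Set (Set ℕ) :=
  {L | IsLanguage L ∧ ∀ T : Text, T.content = L → δ (G h T) T}

/-- The set of all classes of languages each of whose members is learned by one and the same
partial computable learner. -/
def TxtGLearnable (δ : Restriction) : Set (Set (Set ℕ)) :=
  {𝓛 | ∃ h : DataSeq →. ℕ, Partrec h ∧ 𝓛 ⊆ TxtG δ h}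

end InductiveInference

namespace InductiveInference

open Encodable Denumerable

/-! ### Computability -/

/-! Inclusion: let `h` be a weakly monotone learner, made total by delaying it. The new learner
keeps a growing sequence `σ` of data already seen and conjectures `limit h B σ`: the data of `σ`,
together with what `W (h σ)` enumerates while no data from it are found to change the mind of `h`
above `σ`. It drops `σ` only when it holds both a mind change `ρ` and a datum apparently missing
from the limit; the new sequence is `σ` followed by `ρ` and by all data seen. The abandoned set then
really misses a datum seen (`Refutes.exists_not_mem_limit`), and all later conjectures contain that
datum, so there is no semantic return. Infinitely many updates would build a text for the language
on which `h` changes its mind infinitely often (`current_eventually_constant`). A sequence that is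
never refuted has the right limit (`limit_eq_of_forall_update_eq`); weak monotonicity is what
excludes a limit that is too large (`limit_subset_of_subset_limit`).

Properness: for each learner number `e`, search for data `σ` over column `e` on which learner `e`
conjectures a set containing the data of `σ` and some further `y`. The class contains the data of
the first such `σ`, or the whole column if there is none. Learner `e` fails on this set: in the
first case weak monotonicity never lets it give up `y`, and in the second it never generalizes to
the infinite column. A strongly decisive learner needs only the conjectures empty set, column,
finite set, in that order. -/

theorem exists_primrec_approx {α : Type*} [Primcodable α] {f : α →. ℕ} (hf : Partrec f) :
    ∃ F : ℕ → α → Option ℕ, Primrec₂ F ∧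
      (∀ s t a y, s ≤ t → y ∈ F s a → y ∈ F t a) ∧ ∀ a y, y ∈ f a ↔ ∃ s, y ∈ F s a := by
  obtain ⟨c, hc⟩ := Nat.Partrec.Code.exists_code.1 hf
  refine ⟨fun s a => c.evaln s (encode a), ?_, ?_, ?_⟩
  · exact Nat.Partrec.Code.primrec_evaln.comp
      (.pair (.pair .fst (.const c)) (Primrec.encode.comp .snd))
  · intro s t a y hst h
    exact Nat.Partrec.Code.evaln_mono hst h
  · intro a y
    rw [← Nat.Partrec.Code.evaln_complete, hc]
    simp

theorem exists_stages {φ : ℕ → ℕ →. ℕ} (hφ : Partrec₂ φ) :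
    ∃ B : ℕ → ℕ → Set ℕ, PrimrecPred (fun p : (ℕ × ℕ) × ℕ => p.2 ∈ B p.1.1 p.1.2) ∧
      (∀ e, Monotone (B e)) ∧ ∀ e, W φ e = ⋃ s, B e s := by
  obtain ⟨F, hF, hmono, hspec⟩ := exists_primrec_approx (f := fun p : ℕ × ℕ => φ p.1 p.2) hφ
  refine ⟨fun e s => {x | (F s (e, x)).isSome}, ?_, ?_, ?_⟩
  · have : Primrec fun p : (ℕ × ℕ) × ℕ => (F p.1.2 (p.1.1, p.2)).isSome :=
      Primrec.option_isSome.comp (hF.comp (Primrec.snd.comp .fst)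
        (.pair (Primrec.fst.comp .fst) .snd))
    exact ⟨fun p => inferInstanceAs (Decidable ((F p.1.2 (p.1.1, p.2)).isSome = true)),
      this.of_eq fun p => by simp⟩
  · intro e s t hst x hx
    obtain ⟨y, hy⟩ := Option.isSome_iff_exists.1 hx
    exact Option.isSome_iff_exists.2 ⟨y, hmono _ _ _ _ hst hy⟩
  · intro e
    ext x
    simp only [W, PFun.mem_dom, hspec (e, x), Set.mem_iUnion, Set.mem_ofPred_eq,
      Option.isSome_iff_exists]
    exact exists_comm

/-- An unbounded search for `s` halts exactly on the set described; acceptability turns the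
parameter `a` into a program for this search. -/
theorem exists_index {φ : ℕ → ℕ →. ℕ} (hφ : IsAcceptable φ) {α : Type*} [Primcodable α]
    {R : (α × ℕ) × ℕ → Prop} (hR : PrimrecPred R) :
    ∃ g : α → ℕ, Computable g ∧ ∀ a, W φ (g a) = {x | ∃ s, R ((a, x), s)} := by
  obtain ⟨_, hR⟩ := hR
  have h₁ : Partrec fun p : α × ℕ => Nat.rfind fun s => Part.some (decide (R (p, s))) :=
    Partrec.rfind hR.to_comp.partrec.to₂
  have h₂ : Partrec₂ fun (e x : ℕ) => ((decode e : Option α) : Part α).bind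
      fun a => Nat.rfind fun s => Part.some (decide (R ((a, x), s))) := by
    refine Partrec.bind (Computable.ofOption (Computable.decode.comp .fst)) ?_
    exact h₁.comp (.pair .snd (Computable.snd.comp .fst))
  obtain ⟨f, hf, hfψ⟩ := hφ.2 _ h₂
  refine ⟨fun a => f (encode a), hf.comp .encode, fun a => ?_⟩
  ext x
  simp only [W, hfψ, PFun.Dom, encodek, Part.coe_some, Part.bind_some, Set.mem_ofPred_eq]
  refine Nat.rfind_dom.trans ?_
  simp

theorem primrecPred_forall_mem {α β : Type*} [Primcodable α] [Primcodable β] {f : β → List α}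
    {R : α → β → Prop} (hf : Primrec f) (hR : PrimrecPred fun p : α × β => R p.1 p.2) :
    PrimrecPred fun b => ∀ a ∈ f b, R a b :=
  (PrimrecRel.forall_mem_list (R := R) hR).comp hf .id

theorem primrecPred_exists_mem {α β : Type*} [Primcodable α] [Primcodable β] {f : β → List α}
    {R : α → β → Prop} (hf : Primrec f) (hR : PrimrecPred fun p : α × β => R p.1 p.2) :
    PrimrecPred fun b => ∃ a ∈ f b, R a b :=
  (PrimrecRel.exists_mem_list (R := R) hR).comp hf .id

theorem primrecPred_forall_lt {β : Type*} [Primcodable β] {f : β → ℕ}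
    {R : ℕ → β → Prop} (hf : Primrec f) (hR : PrimrecPred fun p : ℕ × β => R p.1 p.2) :
    PrimrecPred fun b => ∀ n < f b, R n b :=
  (primrecPred_forall_mem (Primrec.list_range.comp hf) hR).of_eq (by simp)

theorem primrecPred_exists_lt {β : Type*} [Primcodable β] {f : β → ℕ}
    {R : ℕ → β → Prop} (hf : Primrec f) (hR : PrimrecPred fun p : ℕ × β => R p.1 p.2) :
    PrimrecPred fun b => ∃ n < f b, R n b :=
  (primrecPred_exists_mem (Primrec.list_range.comp hf) hR).of_eq (by simp)

theorem primrecPred_forall_content {β : Type*} [Primcodable β] {f : β → DataSeq}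
    {R : ℕ → β → Prop} (hf : Primrec f) (hR : PrimrecPred fun p : ℕ × β => R p.1 p.2) :
    PrimrecPred fun b => ∀ x, some x ∈ f b → R x b :=
  (primrecPred_forall_mem (Primrec.listFilterMap (g := fun _ o => o) hf .snd) hR).of_eq (by simp)

theorem primrecPred_exists_content {β : Type*} [Primcodable β] {f : β → DataSeq}
    {R : ℕ → β → Prop} (hf : Primrec f) (hR : PrimrecPred fun p : ℕ × β => R p.1 p.2) :
    PrimrecPred fun b => ∃ x, some x ∈ f b ∧ R x b :=
  (primrecPred_exists_mem (Primrec.listFilterMap (g := fun _ o => o) hf .snd) hR).of_eq (by simp)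

theorem primrecPred_mem_content {β : Type*} [Primcodable β] {f : β → DataSeq} {g : β → ℕ}
    (hf : Primrec f) (hg : Primrec g) : PrimrecPred fun b => some (g b) ∈ f b :=
  (primrecPred_exists_content (R := fun x b => x = g b) hf
    (Primrec.eq.comp .fst (hg.comp .snd))).of_eq (by simp)

theorem primrec_ofNat_dataSeq : Primrec (ofNat DataSeq) :=
  Primrec.ofNat DataSeq

/-! ### Finite data and texts -/

theorem Text.length_init (T : Text) (n : ℕ) : (T.init n).length = n := by simp [Text.init]

theorem Text.init_succ (T : Text) (n : ℕ) : T.init (n + 1) = T.init n ++ [T n] := by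
  simp [Text.init, List.range_succ]

theorem Text.take_init (T : Text) {k n : ℕ} (h : k ≤ n) : (T.init n).take k = T.init k := by
  simp [Text.init, List.take_range, ← List.map_take, h]

theorem Text.mem_init {T : Text} {n : ℕ} {o : Option ℕ} :
    o ∈ T.init n ↔ ∃ i < n, T i = o := by
  simp [Text.init]

theorem Text.init_content_subset (T : Text) (n : ℕ) : (T.init n).content ⊆ T.content := by
  intro x hx
  obtain ⟨i, -, hi⟩ := Text.mem_init.1 hx
  exact ⟨i, hi⟩

theorem Text.mem_init_mono {T : Text} {m n : ℕ} (h : m ≤ n) {o : Option ℕ} (ho : o ∈ T.init m) :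
    o ∈ T.init n := by
  obtain ⟨i, hi, hio⟩ := Text.mem_init.1 ho
  exact Text.mem_init.2 ⟨i, hi.trans_le h, hio⟩

theorem Text.exists_mem_init {T : Text} {x : ℕ} (h : x ∈ T.content) : ∃ n, some x ∈ T.init n := by
  obtain ⟨i, hi⟩ := h
  exact ⟨i + 1, Text.mem_init.2 ⟨i, i.lt_succ_self, hi⟩⟩

theorem Text.eq_init_of_initial {T : Text} {n : ℕ} {l : DataSeq} (h : l <+: T.init n) :
    l = T.init l.length := by
  have h' := List.prefix_iff_eq_take.1 h
  have hl : l.length ≤ n := by simpa [Text.length_init] using h.length_le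
  rwa [Text.take_init T hl] at h'

/-- Properties that hold of each datum from some stage on hold of all data jointly
from some stage on. -/
theorem DataSeq.exists_stage {P : ℕ → ℕ → Prop} (hP : ∀ x s t, s ≤ t → P x s → P x t)
    (σ : DataSeq) (h : ∀ x, some x ∈ σ → ∃ s, P x s) :
    ∃ s, ∀ t ≥ s, ∀ x, some x ∈ σ → P x t := by
  induction σ with
  | nil => exact ⟨0, by simp⟩
  | cons o σ ih =>
    obtain ⟨s, hs⟩ := ih fun x hx => h x (List.mem_cons_of_mem _ hx)
    cases o with
    | none => exact ⟨s, by simpa using hs⟩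
    | some y =>
      obtain ⟨t, ht⟩ := h y (by simp)
      refine ⟨max s t, fun u hu x hx => ?_⟩
      rcases List.mem_cons.1 hx with hxy | hx
      · obtain rfl : x = y := by simpa using hxy
        exact hP _ _ _ ((le_max_right _ _).trans hu) ht
      · exact hs u ((le_max_left _ _).trans hu) x hx

/-- The text that presents the data of `σ` and continues with `T`. -/
def Text.prepend (σ : DataSeq) (T : Text) : Text := fun n => (σ[n]?).getD (T (n - σ.length))

theorem Text.init_prepend (σ : DataSeq) (T : Text) (n : ℕ) :
    (Text.prepend σ T).init (σ.length + n) = σ ++ T.init n := by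
  apply List.ext_getElem
  · simp [Text.init]
  · intro i h₁ h₂
    rcases lt_or_ge i σ.length with h | h
    · simp [Text.init, Text.prepend, h]
    · simp [Text.init, Text.prepend, h, List.getElem_append_right]

theorem Text.init_prepend_length (σ : DataSeq) (T : Text) :
    (Text.prepend σ T).init σ.length = σ := by
  simpa [Text.init] using Text.init_prepend σ T 0

theorem Text.content_prepend (σ : DataSeq) (T : Text) :
    (Text.prepend σ T).content = σ.content ∪ T.content := by
  ext x
  constructor
  · intro hx
    obtain ⟨n, hn⟩ := Text.exists_mem_init hx
    have := Text.mem_init_mono (Nat.le_add_left n σ.length) hn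
    rw [Text.init_prepend, List.mem_append] at this
    exact this.imp id fun h => Text.init_content_subset T n h
  · rintro (hx | hx)
    · refine Text.init_content_subset _ σ.length ?_
      rwa [Text.init_prepend_length]
    · obtain ⟨n, hn⟩ := Text.exists_mem_init hx
      refine Text.init_content_subset _ (σ.length + n) ?_
      rw [Text.init_prepend]
      exact List.mem_append_right _ hn

/-! ### Total weakly monotone learners -/

/-- The total learner `h` identifies the language `L` weakly monotonically. -/
structure WeaklyMonotoneLearns (φ : ℕ → ℕ →. ℕ) (h : DataSeq → ℕ) (L : Set ℕ) : Prop where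
  subset : ∀ T : Text, T.content = L → ∀ i j, i ≤ j →
    (T.init j).content ⊆ W φ (h (T.init i)) → W φ (h (T.init i)) ⊆ W φ (h (T.init j))
  converges : ∀ T : Text, T.content = L → ∃ n₀, ∀ n ≥ n₀,
    h (T.init n) = h (T.init n₀) ∧ W φ (h (T.init n₀)) = L

/-- Answer with the value of `h` on the longest prefix on which `h` is seen to halt within
`σ.length` steps. On a text for a learned language this only delays and thins out the learning
sequence. Primitive recursiveness is what later makes stability and refutation decidable. -/
theorem exists_total_learner (φ : ℕ → ℕ →. ℕ) {h : DataSeq →. ℕ} (hh : Partrec h) :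
    ∃ h' : DataSeq → ℕ, Primrec h' ∧
      ∀ L ∈ TxtG (Restriction.both (WMon φ) (Ex φ)) h, WeaklyMonotoneLearns φ h' L := by
  classical
  obtain ⟨F, hF, hmono, hspec⟩ := exists_primrec_approx hh
  -- The default for data on which no computation has halted yet. It agrees with `h []` wherever
  -- that is defined, so even these early answers belong to the original learning sequence.
  obtain ⟨d, hd⟩ : ∃ d, ∀ v ∈ h [], v = d := by
    by_cases hdom : (h []).Dom
    · exact ⟨(h []).get hdom, fun v hv => (Part.get_eq_of_mem hv hdom).symm⟩
    · exact ⟨0, fun v hv => absurd (Part.dom_iff_mem.2 ⟨v, hv⟩) hdom⟩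
  let r : DataSeq → ℕ := fun σ =>
    σ.length.findGreatest fun k => (F σ.length (σ.take k)).isSome = true
  have hr : Primrec r := by
    refine Primrec.nat_findGreatest (p := fun (σ : DataSeq) k =>
      (F σ.length (σ.take k)).isSome = true) Primrec.list_length ?_
    exact Primrec.eq.comp (Primrec.option_isSome.comp
      (hF.comp (Primrec.list_length.comp .fst) (Primrec.list_take.comp .snd .fst))) (.const true)
  refine ⟨fun σ => (F σ.length (σ.take (r σ))).getD d, ?_, ?_⟩
  · exact Primrec.option_getD.comp
      (hF.comp Primrec.list_length (Primrec.list_take.comp hr .id)) (.const d)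
  intro L hL
  -- The delayed sequence is `q ∘ ρ` with `ρ` monotone, unbounded and at most the identity.
  have key : ∀ T : Text, T.content = L → ∃ (q : ℕ → ℕ) (ρ : ℕ → ℕ), G h T = (q : ℕ →. ℕ) ∧
      (∀ i, (F (T.init i).length ((T.init i).take (r (T.init i)))).getD d = q (ρ i)) ∧
      Monotone ρ ∧ (∀ i, ρ i ≤ i) ∧ ∀ n, ∃ i, ∀ j ≥ i, n ≤ ρ j := by
    intro T hT
    obtain ⟨q, hq, -⟩ := (hL.2 T hT).1
    have hq' : ∀ i, h (T.init i) = Part.some (q i) := fun i => congrFun hq i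
    have hle : ∀ i, r (T.init i) ≤ i := fun i =>
      (Nat.findGreatest_le _).trans (Text.length_init T i).le
    have htake : ∀ i, (T.init i).take (r (T.init i)) = T.init (r (T.init i)) := fun i =>
      Text.take_init T (hle i)
    have hgreat : ∀ i k, k ≤ i → (F i (T.init k)).isSome = true → k ≤ r (T.init i) := by
      intro i k hki hk
      refine Nat.le_findGreatest (by simpa [Text.length_init] using hki) ?_
      simpa only [Text.length_init, Text.take_init T hki] using hk
    have hsome : ∀ i, r (T.init i) ≠ 0 → (F i (T.init (r (T.init i)))).isSome = true := by
      intro i hi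
      have : (F (T.init i).length ((T.init i).take (r (T.init i)))).isSome = true :=
        Nat.findGreatest_of_ne_zero
          (P := fun k => (F (T.init i).length ((T.init i).take k)).isSome = true) rfl hi
      rwa [Text.length_init, htake i] at this
    refine ⟨q, fun i => r (T.init i), hq, fun i => ?_, fun i j hij => ?_, hle, fun n => ?_⟩
    · rw [htake, Text.length_init]
      cases hv : F i (T.init (r (T.init i))) with
      | some v =>
        have := (hspec _ _).2 ⟨i, hv⟩
        rw [hq'] at this
        simpa using this
      | none =>
        have h0 : r (T.init i) = 0 := by
          by_contra hne
          simpa [hv] using hsome i hne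
        have := hd (q 0) (by rw [show ([] : DataSeq) = T.init 0 from rfl, hq' 0]; simp)
        simp [h0, this]
    · rcases Nat.eq_zero_or_pos (r (T.init i)) with h0 | h0
      · simp [h0]
      · obtain ⟨v, hv⟩ := Option.isSome_iff_exists.1 (hsome i h0.ne')
        exact hgreat j _ ((hle i).trans hij)
          (Option.isSome_iff_exists.2 ⟨v, hmono _ _ _ _ hij hv⟩)
    · obtain ⟨s, hs⟩ := (hspec (T.init n) (q n)).1 (by rw [hq']; simp)
      refine ⟨max s n, fun j hj => hgreat j n ((le_max_right _ _).trans hj) ?_⟩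
      exact Option.isSome_iff_exists.2 ⟨_, hmono _ _ _ _ ((le_max_left _ _).trans hj) hs⟩
  constructor
  · intro T hT i j hij hsub
    obtain ⟨q, ρ, hq, hqr, hρ, hle, -⟩ := key T hT
    obtain ⟨q', hq', hmon⟩ := (hL.2 T hT).1
    obtain rfl : q = q' := PFun.lift_injective (hq.symm.trans hq')
    simp only [hqr] at hsub ⊢
    rcases (hρ hij).eq_or_lt with heq | hlt
    · rw [heq]
    -- As `ρ j ≤ j`, consistency with the data up to `j` gives consistency with the fewer data that
    -- `q (ρ j)` is based on.
    · exact hmon _ _ hlt fun x hx => hsub (Text.mem_init_mono (hle j) hx)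
  · intro T hT
    obtain ⟨q, ρ, hq, hqr, -, -, hub⟩ := key T hT
    obtain ⟨q', hq', n₀, hn₀⟩ := (hL.2 T hT).2
    obtain rfl : q = q' := PFun.lift_injective (hq.symm.trans hq')
    obtain ⟨i, hi⟩ := hub n₀
    refine ⟨i, fun n hn => ?_⟩
    simp only [hqr]
    obtain ⟨h₁, h₂⟩ := hn₀ _ (hi n hn)
    have h₃ := (hn₀ _ (hi i le_rfl)).1
    rw [h₁, h₃]
    exact ⟨rfl, h₂.trans hT⟩

/-! ### From weakly monotone to strongly decisive learners

A conjecture `h σ` of a weakly monotone learner `h` is replaced by an index of `limit h B σ`, which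
follows the enumeration `B` of `W (h σ)` only as long as `h` shows no mind change above `σ` on the
data enumerated so far. -/

/-- At stage `t`, the conjecture `h σ` is consistent with `σ`, and no mind change of `h` above `σ`
on data from the conjecture has been found. -/
def Stable (h : DataSeq → ℕ) (B : ℕ → ℕ → Set ℕ) (σ : DataSeq) (t : ℕ) : Prop :=
  (∀ y, some y ∈ σ → y ∈ B (h σ) t) ∧
    ∀ n < t, (∀ y, some y ∈ ofNat DataSeq n → y ∈ B (h σ) t) → h (σ ++ ofNat DataSeq n) = h σ

/-- The part of `limit h B σ` that is enumerated up to stage `s`. -/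
def limitStage (h : DataSeq → ℕ) (B : ℕ → ℕ → Set ℕ) (σ : DataSeq) (s : ℕ) : Set ℕ :=
  {x | some x ∈ σ ∨ ∃ t < s + 1, Stable h B σ t ∧ x ∈ B (h σ) t}

/-- The data of `σ` together with the part of the conjecture `h σ` that is enumerated at stages
where the conjecture is stable. -/
def limit (h : DataSeq → ℕ) (B : ℕ → ℕ → Set ℕ) (σ : DataSeq) : Set ℕ :=
  {x | ∃ s, x ∈ limitStage h B σ s}

/-- The data `l` refute `limit h B σ`, with `n` coding a mind change of `h` above `σ`. -/
def Refutes (h : DataSeq → ℕ) (B : ℕ → ℕ → Set ℕ) (σ l : DataSeq) (n : ℕ) : Prop :=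
  (∀ y, some y ∈ ofNat DataSeq n → some y ∈ l) ∧ h (σ ++ ofNat DataSeq n) ≠ h σ ∧
    ∃ x, some x ∈ l ∧ x ∉ limitStage h B σ l.length

open Classical in
/-- The update of the current sequence `σ` on data `l`. -/
noncomputable def update (h : DataSeq → ℕ) (B : ℕ → ℕ → Set ℕ) (σ l : DataSeq) : DataSeq :=
  if Refutes h B σ l (l.length.findGreatest (Refutes h B σ l)) then
    σ ++ ofNat DataSeq (l.length.findGreatest (Refutes h B σ l)) ++ l
  else σ

/-- The current sequence after the data `l`. -/
noncomputable def current (h : DataSeq → ℕ) (B : ℕ → ℕ → Set ℕ) (l : DataSeq) : DataSeq :=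
  (l.foldl (fun p o => (p.1 ++ [o], update h B p.2 (p.1 ++ [o]))) (([], []) : DataSeq × DataSeq)).2

/-! ### Primitive recursiveness of the current sequence. -/

section Computability

variable {h : DataSeq → ℕ} {B : ℕ → ℕ → Set ℕ}

theorem primrecPred_mem_stage (hB : PrimrecPred fun p : (ℕ × ℕ) × ℕ => p.2 ∈ B p.1.1 p.1.2)
    {β : Type*} [Primcodable β] {e s x : β → ℕ} (he : Primrec e) (hs : Primrec s)
    (hx : Primrec x) : PrimrecPred fun b => x b ∈ B (e b) (s b) :=
  hB.comp (.pair (.pair he hs) hx)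

theorem primrecPred_content_subset_stage
    (hB : PrimrecPred fun p : (ℕ × ℕ) × ℕ => p.2 ∈ B p.1.1 p.1.2)
    {β : Type*} [Primcodable β] {e s : β → ℕ} {f : β → DataSeq} (he : Primrec e) (hs : Primrec s)
    (hf : Primrec f) : PrimrecPred fun b => ∀ y, some y ∈ f b → y ∈ B (e b) (s b) :=
  primrecPred_forall_content (R := fun y b => y ∈ B (e b) (s b)) hf
    (primrecPred_mem_stage hB (he.comp .snd) (hs.comp .snd) .fst)

theorem primrecPred_stable (hh : Primrec h)
    (hB : PrimrecPred fun p : (ℕ × ℕ) × ℕ => p.2 ∈ B p.1.1 p.1.2) :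
    PrimrecPred fun p : DataSeq × ℕ => Stable h B p.1 p.2 := by
  refine (primrecPred_content_subset_stage hB (hh.comp .fst) .snd .fst).and ?_
  refine primrecPred_forall_lt (R := fun n (p : DataSeq × ℕ) =>
    (∀ y, some y ∈ ofNat DataSeq n → y ∈ B (h p.1) p.2) → h (p.1 ++ ofNat DataSeq n) = h p.1)
    .snd ?_
  have hρ : Primrec fun q : ℕ × DataSeq × ℕ => ofNat DataSeq q.1 := primrec_ofNat_dataSeq.comp .fst
  have hσ : Primrec fun q : ℕ × DataSeq × ℕ => q.2.1 := Primrec.fst.comp .snd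
  have h₁ := primrecPred_content_subset_stage hB (hh.comp hσ) (Primrec.snd.comp .snd) hρ
  have h₂ : PrimrecPred fun q : ℕ × DataSeq × ℕ => h (q.2.1 ++ ofNat DataSeq q.1) = h q.2.1 :=
    Primrec.eq.comp (hh.comp (Primrec.list_append.comp hσ hρ)) (hh.comp hσ)
  exact (h₁.not.or h₂).of_eq fun q => imp_iff_not_or.symm

theorem primrecPred_limitStage (hh : Primrec h)
    (hB : PrimrecPred fun p : (ℕ × ℕ) × ℕ => p.2 ∈ B p.1.1 p.1.2) :
    PrimrecPred fun p : (DataSeq × ℕ) × ℕ => p.1.2 ∈ limitStage h B p.1.1 p.2 := by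
  refine (primrecPred_mem_content (Primrec.fst.comp .fst) (Primrec.snd.comp .fst)).or ?_
  refine primrecPred_exists_lt (R := fun t (p : (DataSeq × ℕ) × ℕ) =>
    Stable h B p.1.1 t ∧ p.1.2 ∈ B (h p.1.1) t) (Primrec.succ.comp .snd) ?_
  have hσ : Primrec fun q : ℕ × (DataSeq × ℕ) × ℕ => q.2.1.1 :=
    Primrec.fst.comp (Primrec.fst.comp .snd)
  exact ((primrecPred_stable hh hB).comp (hσ.pair .fst)).and
    (primrecPred_mem_stage hB (hh.comp hσ) .fst (Primrec.snd.comp (Primrec.fst.comp .snd)))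

theorem primrecPred_refutes (hh : Primrec h)
    (hB : PrimrecPred fun p : (ℕ × ℕ) × ℕ => p.2 ∈ B p.1.1 p.1.2) :
    PrimrecPred fun p : (DataSeq × DataSeq) × ℕ => Refutes h B p.1.1 p.1.2 p.2 := by
  have hρ : Primrec fun p : (DataSeq × DataSeq) × ℕ => ofNat DataSeq p.2 :=
    primrec_ofNat_dataSeq.comp .snd
  have hσ : Primrec fun p : (DataSeq × DataSeq) × ℕ => p.1.1 := Primrec.fst.comp .fst
  have hl : Primrec fun p : (DataSeq × DataSeq) × ℕ => p.1.2 := Primrec.snd.comp .fst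
  have h₁ := primrecPred_forall_content (R := fun y (p : (DataSeq × DataSeq) × ℕ) =>
    some y ∈ p.1.2) hρ (primrecPred_mem_content (hl.comp .snd) .fst)
  have h₂ : PrimrecPred fun p : (DataSeq × DataSeq) × ℕ =>
      ¬ h (p.1.1 ++ ofNat DataSeq p.2) = h p.1.1 :=
    (Primrec.eq.comp (hh.comp (Primrec.list_append.comp hσ hρ)) (hh.comp hσ)).not
  have h₃ := primrecPred_exists_content (R := fun x (p : (DataSeq × DataSeq) × ℕ) =>
    x ∉ limitStage h B p.1.1 p.1.2.length) hl
    ((primrecPred_limitStage hh hB).comp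
      (.pair (.pair (hσ.comp .snd) .fst) (Primrec.list_length.comp (hl.comp .snd)))).not
  exact h₁.and (h₂.and h₃)

theorem primrec_current (hh : Primrec h)
    (hB : PrimrecPred fun p : (ℕ × ℕ) × ℕ => p.2 ∈ B p.1.1 p.1.2) :
    Primrec (current h B) := by
  classical
  have hR := primrecPred_refutes hh hB
  have hn : Primrec fun p : DataSeq × DataSeq => p.2.length.findGreatest (Refutes h B p.1 p.2) :=
    Primrec.nat_findGreatest (p := fun (p : DataSeq × DataSeq) n => Refutes h B p.1 p.2 n)
      (Primrec.list_length.comp .snd) hR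
  have hu : Primrec fun p : DataSeq × DataSeq => update h B p.1 p.2 :=
    Primrec.ite (hR.comp (Primrec.pair .id hn))
      (Primrec.list_append.comp
        (Primrec.list_append.comp .fst (primrec_ofNat_dataSeq.comp hn)) .snd) .fst
  have ha : Primrec fun q : DataSeq × (DataSeq × DataSeq) × Option ℕ => q.2.1.1 ++ [q.2.2] :=
    Primrec.list_concat.comp (Primrec.fst.comp (Primrec.fst.comp .snd)) (Primrec.snd.comp .snd)
  refine Primrec.snd.comp (Primrec.list_foldl
    (h := fun _ (q : (DataSeq × DataSeq) × Option ℕ) =>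
      (q.1.1 ++ [q.2], update h B q.1.2 (q.1.1 ++ [q.2]))) .id (.const ([], [])) ?_)
  exact Primrec.pair ha (hu.comp (.pair (Primrec.snd.comp (Primrec.fst.comp .snd)) ha))

end Computability

/-! ### Strong decisiveness and convergence of the new learner. -/

section Correctness

variable {φ : ℕ → ℕ →. ℕ} {h : DataSeq → ℕ} {B : ℕ → ℕ → Set ℕ}

theorem current_concat (l : DataSeq) (o : Option ℕ) :
    current h B (l ++ [o]) = update h B (current h B l) (l ++ [o]) := by
  have : ∀ l : DataSeq, (l.foldl (fun p o => (p.1 ++ [o], update h B p.2 (p.1 ++ [o])))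
      (([], []) : DataSeq × DataSeq)).1 = l := by
    intro l
    induction l using List.reverseRecOn with
    | nil => rfl
    | append_singleton l o ih => simp [ih]
  simp [current, this l]

theorem current_init_succ (T : Text) (n : ℕ) : current h B (T.init (n + 1)) =
    update h B (current h B (T.init n)) (T.init (n + 1)) := by
  rw [Text.init_succ, current_concat]

theorem update_cases (σ l : DataSeq) :
    (update h B σ l = σ ∧ ∀ n ≤ l.length, ¬ Refutes h B σ l n) ∨
      ∃ n ≤ l.length, Refutes h B σ l n ∧ update h B σ l = σ ++ ofNat DataSeq n ++ l := by
  classical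
  by_cases hR : Refutes h B σ l (l.length.findGreatest (Refutes h B σ l))
  · exact Or.inr ⟨_, Nat.findGreatest_le _, hR, if_pos hR⟩
  · exact Or.inl ⟨if_neg hR, fun n hn hn' =>
      hR (Nat.findGreatest_spec (P := Refutes h B σ l) hn hn')⟩

theorem content_subset_limit {σ : DataSeq} {x : ℕ} (hx : some x ∈ σ) : x ∈ limit h B σ :=
  ⟨0, Or.inl hx⟩

/-- Being absent at stage `l.length` suffices: the missing datum could enter only at a later stable
stage. If all of `l` were in the limit, some stable stage beyond `l.length` would contain all data
of `ρ`, and stability there would deny the mind change coded by `n`. -/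
theorem Refutes.exists_not_mem_limit (hmono : ∀ e, Monotone (B e)) {σ l : DataSeq} {n : ℕ}
    (hR : Refutes h B σ l n) (hn : n ≤ l.length) : ∃ x, some x ∈ l ∧ x ∉ limit h B σ := by
  obtain ⟨hρ, hne, x, hxl, hx⟩ := hR
  by_contra! hcon
  have hmem : ∀ y, some y ∈ l → some y ∈ σ ∨ ∃ t, Stable h B σ t ∧ y ∈ B (h σ) t := by
    intro y hy
    obtain ⟨s, hs⟩ := hcon y hy
    exact hs.imp id fun ⟨t, _, ht⟩ => ⟨t, ht⟩
  obtain ⟨t₀, ht₀, hxt₀⟩ := (hmem x hxl).resolve_left fun hxσ => hx (Or.inl hxσ)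
  have hlt : l.length < t₀ := by
    by_contra! hle
    exact hx (Or.inr ⟨t₀, Nat.lt_succ_of_le hle, ht₀, hxt₀⟩)
  -- The maximum of two stable stages is one of them, so finitely many data share a late stable
  -- stage.
  have key : ∀ l' : DataSeq, (∀ y, some y ∈ l' → some y ∈ l) →
      ∃ t, Stable h B σ t ∧ l.length < t ∧ ∀ y, some y ∈ l' → y ∈ B (h σ) t := by
    intro l'
    induction l' with
    | nil => exact fun _ => ⟨t₀, ht₀, hlt, by simp⟩
    | cons o l' ih =>
      intro hl'
      obtain ⟨t, hst, hltt, ht⟩ := ih fun y hy => hl' y (List.mem_cons_of_mem _ hy)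
      cases o with
      | none => exact ⟨t, hst, hltt, by simpa using ht⟩
      | some z =>
        rcases hmem z (hl' z (by simp)) with hz | ⟨u, hsu, hzu⟩
        · refine ⟨t, hst, hltt, fun y hy => ?_⟩
          rcases List.mem_cons.1 hy with hyz | hy
          · obtain rfl : y = z := by simpa using hyz
            exact hst.1 y hz
          · exact ht y hy
        · refine ⟨max t u, by rcases max_choice t u with e | e <;> rwa [e],
            lt_max_of_lt_left hltt, fun y hy => ?_⟩
          rcases List.mem_cons.1 hy with hyz | hy
          · obtain rfl : y = z := by simpa using hyz
            exact hmono _ (le_max_right t u) hzu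
          · exact hmono _ (le_max_left t u) (ht y hy)
  obtain ⟨t, hst, hltt, ht⟩ := key l fun _ hy => hy
  -- From `n ≤ l.length < t`, the code `n` is among those tested at stage `t`.
  exact hne (hst.2 n (hn.trans_lt hltt) fun y hy => ht y (hρ y hy))

theorem content_current_subset (T : Text) (n : ℕ) {x : ℕ} (hx : some x ∈ current h B (T.init n)) :
    some x ∈ T.init n := by
  induction n with
  | zero => simp [Text.init, current] at hx
  | succ n ih =>
    have hmono : ∀ {y}, some y ∈ T.init n → some y ∈ T.init (n + 1) :=
      Text.mem_init_mono n.le_succ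
    rw [current_init_succ] at hx
    rcases update_cases (h := h) (B := B) (current h B (T.init n)) (T.init (n + 1)) with
      ⟨he, -⟩ | ⟨m, -, hR, he⟩
    · rw [he] at hx
      exact hmono (ih hx)
    · rw [he, List.mem_append, List.mem_append] at hx
      rcases hx with (hx | hx) | hx
      exacts [hmono (ih hx), hR.1 x hx, hx]

theorem current_mono (T : Text) {m n : ℕ} (hmn : m ≤ n) :
    current h B (T.init m) <+: current h B (T.init n) := by
  induction n, hmn using Nat.le_induction with
  | base => exact List.prefix_refl _
  | succ n _ ih =>
    refine ih.trans ?_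
    rw [current_init_succ]
    rcases update_cases (h := h) (B := B) (current h B (T.init n)) (T.init (n + 1)) with
      ⟨he, -⟩ | ⟨m, -, hR, he⟩
    · rw [he]
    · rw [he, List.append_assoc]
      exact List.prefix_append _ _

/-- As soon as the current sequence changes, its data witness that the abandoned conjecture is
wrong. -/
theorem current_eq_or_exists_not_mem_limit (hmono : ∀ e, Monotone (B e)) (T : Text) {i k : ℕ}
    (hik : i ≤ k) : (∀ j, i ≤ j → j ≤ k → current h B (T.init j) = current h B (T.init i)) ∨
      ∃ x, some x ∈ current h B (T.init k) ∧ x ∉ limit h B (current h B (T.init i)) := by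
  induction k, hik using Nat.le_induction with
  | base =>
    left
    intro j h₁ h₂
    rw [le_antisymm h₂ h₁]
  | succ k hik ih =>
    rcases ih with ih | ⟨x, hx, hxi⟩
    · rcases update_cases (h := h) (B := B) (current h B (T.init k)) (T.init (k + 1)) with
        ⟨he, -⟩ | ⟨m, hm, hR, he⟩
      · left
        intro j h₁ h₂
        rcases Nat.le_succ_iff.1 h₂ with h₂ | rfl
        · exact ih j h₁ h₂
        · rw [current_init_succ, he, ih k hik le_rfl]
      · right
        obtain ⟨x, hx, hxk⟩ := hR.exists_not_mem_limit hmono hm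
        rw [ih k hik le_rfl] at hxk
        refine ⟨x, ?_, hxk⟩
        rw [current_init_succ, he]
        exact List.mem_append_right _ hx
    · exact Or.inr ⟨x, (current_mono T k.le_succ).subset hx, hxi⟩

/-- With infinitely many updates the current sequences grow into a text `T'`. It presents exactly
`L`, since each update appends all data seen and nothing foreign is ever added. Both `σ` and `σ ++
ρ` are initial parts of `T'`, so `h` would not converge on it. -/
theorem current_eventually_constant {L : Set ℕ} (hL : WeaklyMonotoneLearns φ h L) {T : Text}
    (hT : T.content = L) :
    ∃ N, ∀ n ≥ N, current h B (T.init (n + 1)) = current h B (T.init n) := by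
  by_contra! hcon
  have hgrow : ∀ n, current h B (T.init (n + 1)) ≠ current h B (T.init n) →
      ∃ ρ, h (current h B (T.init n) ++ ρ) ≠ h (current h B (T.init n)) ∧
        current h B (T.init (n + 1)) = current h B (T.init n) ++ ρ ++ T.init (n + 1) := by
    intro n hn
    rcases update_cases (h := h) (B := B) (current h B (T.init n)) (T.init (n + 1)) with
      ⟨he, -⟩ | ⟨m, -, hR, he⟩
    · exact absurd ((current_init_succ T n).trans he) hn
    · exact ⟨_, hR.2.1, (current_init_succ T n).trans he⟩
  have hlen : ∀ k, ∃ m, k < (current h B (T.init m)).length := by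
    intro k
    obtain ⟨n, hkn, hn⟩ := hcon k
    obtain ⟨ρ, -, he⟩ := hgrow n hn
    refine ⟨n + 1, ?_⟩
    simp only [he, List.length_append, Text.length_init]
    omega
  choose m hm using hlen
  let T' : Text := fun k => (current h B (T.init (m k)))[k]'(hm k)
  have hinit : ∀ n, current h B (T.init n) = T'.init (current h B (T.init n)).length := by
    intro n
    refine List.ext_getElem (by simp [Text.init]) fun k h₁ h₂ => ?_
    simp only [Text.init, List.getElem_map, List.getElem_range, T']
    rcases le_total n (m k) with hle | hle
    · exact (current_mono T hle).getElem h₁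
    · exact ((current_mono T hle).getElem (hm k)).symm
  have hT' : T'.content = L := by
    rw [← hT]
    refine Set.Subset.antisymm ?_ fun x hx => ?_
    · rintro x ⟨k, hk⟩
      refine Text.init_content_subset T (m k) (content_current_subset (h := h) (B := B) T (m k) ?_)
      exact hk ▸ List.getElem_mem _
    · obtain ⟨i, hi⟩ := Text.exists_mem_init hx
      obtain ⟨n, hin, hn⟩ := hcon i
      obtain ⟨ρ, -, he⟩ := hgrow n hn
      refine Text.init_content_subset T' (current h B (T.init (n + 1))).length ?_
      rw [← hinit, he]
      exact List.mem_append_right _ (Text.mem_init_mono (hin.trans n.le_succ) hi)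
  obtain ⟨n₀, hn₀⟩ := hL.converges T' hT'
  obtain ⟨n, hmn, hn⟩ := hcon (m n₀)
  obtain ⟨ρ, hρ, he⟩ := hgrow n hn
  have h₀ : n₀ ≤ (current h B (T.init n)).length :=
    (hm n₀).le.trans (current_mono T hmn).length_le
  have hpre : current h B (T.init n) ++ ρ =
      T'.init (current h B (T.init n) ++ ρ).length := by
    refine Text.eq_init_of_initial (n := (current h B (T.init (n + 1))).length) ?_
    rw [← hinit, he]
    exact List.prefix_append _ _
  apply hρ
  rw [hpre, (hn₀ _ (h₀.trans (by simp))).1]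
  conv_rhs => rw [hinit n, (hn₀ _ h₀).1]

/-- An element of the limit outside `σ` comes from a stable stage, so `W (h σ)` contains the data of
`σ` and hence all of `L`. On the text `σ` followed by `T`, the conjecture `h σ` stays consistent,
and weak monotonicity puts it inside the final conjecture `L`. -/
theorem limit_subset_of_subset_limit {L : Set ℕ} (hW : ∀ e, W φ e = ⋃ s, B e s)
    (hL : WeaklyMonotoneLearns φ h L) {T : Text}
    (hT : T.content = L) {σ : DataSeq} (hσ : σ.content ⊆ L) (hsub : L ⊆ limit h B σ) :
    limit h B σ ⊆ L := by
  rintro x ⟨s, hx | ⟨t, -, hst, hxt⟩⟩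
  · exact hσ hx
  have hmem : ∀ {y u}, y ∈ B (h σ) u → y ∈ W φ (h σ) := fun hy => by
    rw [hW]
    exact Set.mem_iUnion.2 ⟨_, hy⟩
  have hLW : L ⊆ W φ (h σ) := by
    intro y hy
    obtain ⟨s, hy | ⟨u, -, -, hyu⟩⟩ := hsub hy
    exacts [hmem (hst.1 y hy), hmem hyu]
  have hT' : (Text.prepend σ T).content = L := by
    rw [Text.content_prepend, hT, Set.union_eq_self_of_subset_left hσ]
  obtain ⟨n₀, hn₀⟩ := hL.converges _ hT'
  have h₁ := hL.subset _ hT' σ.length (max σ.length n₀) (le_max_left _ _)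
  rw [Text.init_prepend_length] at h₁
  have h₂ := h₁ ((Text.init_content_subset _ _).trans (hT'.subset.trans hLW)) (hmem hxt)
  obtain ⟨h₃, h₄⟩ := hn₀ _ (le_max_right σ.length n₀)
  rwa [h₃, h₄] at h₂

/-- If the limit missed some `x` in `L`, any mind change of `h` above `σ` on data from `L` would
eventually give a refutation. So there is none, whence `W (h σ) = L`; then all late stages are
stable and `x` is enumerated after all. -/
theorem limit_eq_of_forall_update_eq {L : Set ℕ} (hmono : ∀ e, Monotone (B e))
    (hW : ∀ e, W φ e = ⋃ s, B e s) (hL : WeaklyMonotoneLearns φ h L) {T : Text}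
    (hT : T.content = L) {σ : DataSeq} (hσ : σ.content ⊆ L) {N : ℕ}
    (hR : ∀ n ≥ N, ∀ m ≤ n, ¬ Refutes h B σ (T.init n) m) : limit h B σ = L := by
  by_cases hsub : L ⊆ limit h B σ
  · exact (limit_subset_of_subset_limit hW hL hT hσ hsub).antisymm hsub
  obtain ⟨x, hxL, hx⟩ := Set.not_subset.1 hsub
  exfalso
  have hstab : ∀ ρ : DataSeq, ρ.content ⊆ L → h (σ ++ ρ) = h σ := by
    intro ρ hρ
    by_contra hne
    obtain ⟨i, hi⟩ := Text.exists_mem_init (hT.superset hxL)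
    obtain ⟨s, hs⟩ := DataSeq.exists_stage (P := fun y n => some y ∈ T.init n)
      (fun y s t hst hy => Text.mem_init_mono hst hy) ρ
      fun y hy => Text.exists_mem_init (hT.superset (hρ hy))
    -- Late enough for the data of `ρ` and the missing `x` to have appeared, and for the code of `ρ`
    -- to be within the search bound.
    refine hR (max (max N s) (max i (encode ρ))) (by simp) (encode ρ) (by simp) ⟨?_, ?_, x, ?_, ?_⟩
    · rw [ofNat_encode]
      exact hs _ (by simp)
    · rwa [ofNat_encode]
    · exact Text.mem_init_mono (by simp) hi
    · exact fun h' => hx ⟨_, h'⟩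
  have hT' : (Text.prepend σ T).content = L := by
    rw [Text.content_prepend, hT, Set.union_eq_self_of_subset_left hσ]
  obtain ⟨n₀, hn₀⟩ := hL.converges _ hT'
  have hWσ : W φ (h σ) = L := by
    obtain ⟨h₁, h₂⟩ := hn₀ _ (Nat.le_add_left n₀ σ.length)
    rw [Text.init_prepend, hstab _ ((Text.init_content_subset T n₀).trans hT.subset)] at h₁
    rw [h₁, h₂]
  have hBL : ∀ t, B (h σ) t ⊆ L := fun t => by
    rw [← hWσ, hW]
    exact Set.subset_iUnion _ t
  have hLB : ∀ y ∈ L, ∃ t, y ∈ B (h σ) t := fun y hy => by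
    rw [← hWσ, hW] at hy
    exact Set.mem_iUnion.1 hy
  obtain ⟨s, hs⟩ := DataSeq.exists_stage (P := fun y t => y ∈ B (h σ) t)
    (fun y s t hst hy => hmono _ hst hy) σ fun y hy => hLB y (hσ hy)
  obtain ⟨t, ht⟩ := hLB x hxL
  refine hx ⟨max s t, Or.inr ⟨max s t, Nat.lt_succ_self _, ⟨hs _ (le_max_left _ _), ?_⟩,
    hmono _ (le_max_right _ _) ht⟩⟩
  exact fun n _ hn => hstab _ fun y hy => hBL _ (hn y hy)

end Correctness

theorem wMon_subset_sDec {φ : ℕ → ℕ →. ℕ} (hφ : IsAcceptable φ) :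
    TxtGLearnable (Restriction.both (WMon φ) (Ex φ)) ⊆
      TxtGLearnable (Restriction.both (SDec φ) (Ex φ)) := by
  rintro 𝓛 ⟨h₀, hh₀, h𝓛⟩
  obtain ⟨h, hh, hlearn⟩ := exists_total_learner φ hh₀
  obtain ⟨B, hB, hmono, hW⟩ := exists_stages hφ.1
  obtain ⟨g, hg, hgW⟩ := exists_index hφ (primrecPred_limitStage hh hB)
  change ∀ σ, W φ (g σ) = limit h B σ at hgW
  refine ⟨((fun l => g (current h B l) : DataSeq → ℕ) : DataSeq →. ℕ),
    (hg.comp (primrec_current hh hB).to_comp).partrec, fun L hL => ⟨(h𝓛 hL).1, fun T hT => ?_⟩⟩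
  have hL' := hlearn L (h𝓛 hL)
  refine ⟨⟨fun n => g (current h B (T.init n)), rfl, fun i j k hij hjk hik => ?_⟩,
    ⟨fun n => g (current h B (T.init n)), rfl, ?_⟩⟩
  · rcases current_eq_or_exists_not_mem_limit (h := h) hmono T (hij.trans hjk) with
      he | ⟨x, hx, hxi⟩
    · exact congrArg g (he j hij hjk)
    · rw [hgW, hgW] at hik
      exact absurd (hik ▸ content_subset_limit hx) hxi
  · obtain ⟨N, hN⟩ := current_eventually_constant (B := B) hL' hT
    have hconst : ∀ n ≥ N, current h B (T.init n) = current h B (T.init N) := by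
      intro n hn
      induction n, hn using Nat.le_induction with
      | base => rfl
      | succ n hn ih => rw [hN n hn, ih]
    refine ⟨N, fun n hn => ⟨congrArg g (hconst n hn), ?_⟩⟩
    rw [hgW, hT]
    refine limit_eq_of_forall_update_eq hmono hW hL' hT (N := N + 1)
      (fun x hx => hT.subset (Text.init_content_subset T N (content_current_subset T N hx))) ?_
    rintro n hn m hm hR
    obtain ⟨n, rfl⟩ : ∃ k, n = k + 1 := ⟨n - 1, by omega⟩
    have hn' : N ≤ n := by omega
    have hup := current_init_succ (h := h) (B := B) T n
    rw [hN n hn', hconst n hn'] at hup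
    rcases update_cases (h := h) (B := B) (current h B (T.init N)) (T.init (n + 1)) with
      ⟨-, hno⟩ | ⟨m', -, -, he⟩
    · exact hno m (by rwa [Text.length_init]) hR
    -- An update appends the nonempty `T.init (n + 1)`, so it cannot leave the sequence unchanged.
    · have := congrArg List.length (hup.trans he)
      simp [Text.length_init] at this

/-! ### A class that is learnable strongly decisively but not weakly monotonically -/

/-- The column with number `e`. -/
def column (e : ℕ) : Set ℕ := {x | x.unpair.1 = e}

theorem column_infinite (e : ℕ) : (column e).Infinite :=
  Set.infinite_of_injective_forall_mem (f := fun n => Nat.pair e n)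
    (fun a b hab => (Nat.pair_eq_pair.1 hab).2) fun n => by simp [column]

theorem DataSeq.finite_content (σ : DataSeq) : σ.content.Finite :=
  (σ.finite_toSet.preimage (Option.some_injective ℕ).injOn)

theorem PrimrecPred.rePred {α : Type*} [Primcodable α] {p : α → Prop} (hp : PrimrecPred p) :
    REPred p := by
  obtain ⟨_, hp⟩ := hp
  exact ComputablePred.to_re ⟨inferInstance, hp.to_comp⟩

/-- The data sequence stored in the code `m` of a triple. -/
def seqOf (m : ℕ) : DataSeq := ofNat DataSeq m.unpair.1

/-- With `F s (e, σ)` the conjecture of the learner `e` on `σ` after `s` steps and `B` an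
enumeration of the conjectures, `m` codes a data sequence `σ` over column `e`, a number `y` and a
stage at which the conjecture on `σ` has been seen to contain the data of `σ` and also `y`. -/
def Overgeneralizes (F : ℕ → ℕ × DataSeq → Option ℕ) (B : ℕ → ℕ → Set ℕ) (e m : ℕ) : Prop :=
  (∃ x, some x ∈ seqOf m) ∧ (∀ x, some x ∈ seqOf m → x ∈ column e) ∧
    some m.unpair.2.unpair.1 ∉ seqOf m ∧
    (F m.unpair.2.unpair.2 (e, seqOf m)).isSome = true ∧
    (∀ x, some x ∈ seqOf m →
      x ∈ B ((F m.unpair.2.unpair.2 (e, seqOf m)).getD 0) m.unpair.2.unpair.2) ∧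
    m.unpair.2.unpair.1 ∈ B ((F m.unpair.2.unpair.2 (e, seqOf m)).getD 0) m.unpair.2.unpair.2

/-- `m` is the least number that satisfies `p`. -/
def IsFirst (p : ℕ → Prop) (m : ℕ) : Prop := p m ∧ ∀ k < m, ¬ p k

theorem IsFirst.unique {p : ℕ → Prop} {m n : ℕ} (hm : IsFirst p m) (hn : IsFirst p n) : m = n :=
  le_antisymm (not_lt.1 fun h => hm.2 n h hn.1) (not_lt.1 fun h => hn.2 m h hm.1)

theorem exists_isFirst {p : ℕ → Prop} (h : ∃ m, p m) : ∃ m, IsFirst p m := by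
  classical
  exact ⟨Nat.find h, Nat.find_spec h, fun k hk => Nat.find_min h hk⟩

theorem primrecPred_overgeneralizes {F : ℕ → ℕ × DataSeq → Option ℕ} {B : ℕ → ℕ → Set ℕ}
    (hF : Primrec₂ F) (hB : PrimrecPred fun p : (ℕ × ℕ) × ℕ => p.2 ∈ B p.1.1 p.1.2) :
    PrimrecPred fun p : ℕ × ℕ => Overgeneralizes F B p.1 p.2 := by
  have h₀ : Primrec fun p : ℕ × ℕ => p.2.unpair := Primrec.unpair.comp .snd
  have h₁ : Primrec fun p : ℕ × ℕ => p.2.unpair.2.unpair :=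
    Primrec.unpair.comp (Primrec.snd.comp h₀)
  have hσ : Primrec fun p : ℕ × ℕ => seqOf p.2 :=
    primrec_ofNat_dataSeq.comp (Primrec.fst.comp h₀)
  have hy : Primrec fun p : ℕ × ℕ => p.2.unpair.2.unpair.1 := Primrec.fst.comp h₁
  have hs : Primrec fun p : ℕ × ℕ => p.2.unpair.2.unpair.2 := Primrec.snd.comp h₁
  have hv : Primrec fun p : ℕ × ℕ => F p.2.unpair.2.unpair.2 (p.1, seqOf p.2) :=
    hF.comp hs (Primrec.fst.pair hσ)
  have hv' : Primrec fun p : ℕ × ℕ => (F p.2.unpair.2.unpair.2 (p.1, seqOf p.2)).getD 0 :=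
    Primrec.option_getD.comp hv (.const 0)
  refine PrimrecPred.and (primrecPred_exists_mem (R := fun _ _ => True)
      (Primrec.listFilterMap (g := fun _ o => o) hσ .snd) ?_ |>.of_eq (by simp)) <|
    PrimrecPred.and (primrecPred_forall_content (R := fun x (p : ℕ × ℕ) => x ∈ column p.1) hσ ?_) <|
    (primrecPred_mem_content hσ hy).not.and <|
    PrimrecPred.and (Primrec.eq.comp (Primrec.option_isSome.comp hv) (.const true)) <|
    (primrecPred_content_subset_stage hB hv' hs hσ).and (primrecPred_mem_stage hB hv' hs hy)
  · exact (Primrec.eq.comp (.const 0) (.const 0)).of_eq (by simp)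
  · exact Primrec.eq.comp (Primrec.fst.comp (Primrec.unpair.comp .fst)) (Primrec.fst.comp .snd)

theorem primrecPred_isFirst {p : ℕ → ℕ → Prop} (hp : PrimrecPred fun q : ℕ × ℕ => p q.1 q.2) :
    PrimrecPred fun q : ℕ × ℕ => IsFirst (p q.1) q.2 :=
  hp.and (primrecPred_forall_lt (R := fun k (q : ℕ × ℕ) => ¬ p q.1 k) .snd
    (hp.comp (.pair (Primrec.fst.comp .snd) .fst)).not)

/-- For each `e`, the class contains the data of `seqOf m` for the first `m` with `p e m`, and the
whole column `e` if there is no such `m`. -/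
def firstWitnessClass (p : ℕ → ℕ → Prop) : Set (Set ℕ) :=
  {L | ∃ e, ((∀ m, ¬ p e m) ∧ L = column e) ∨ ∃ m, IsFirst (p e) m ∧ L = (seqOf m).content}

/-- The set described by a data sequence and a list of numbers of columns. -/
def described (d : DataSeq × List ℕ) : Set ℕ := {x | some x ∈ d.1 ∨ x.unpair.1 ∈ d.2}

open Classical in
/-- The description conjectured on data `l`: nothing before the first datum, then the column `e` of
the first datum, until the first `m` with `p e m` shows up. -/
noncomputable def conjecture (p : ℕ → ℕ → Prop) (l : DataSeq) : DataSeq × List ℕ :=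
  ((l.filterMap fun o => o).head?).casesOn ([], []) fun x =>
    if IsFirst (p x.unpair.1) (l.length.findGreatest (IsFirst (p x.unpair.1))) then
      (seqOf (l.length.findGreatest (IsFirst (p x.unpair.1))), [])
    else ([], [x.unpair.1])

theorem primrec_conjecture {p : ℕ → ℕ → Prop}
    (hp : PrimrecPred fun q : ℕ × ℕ => p q.1 q.2) : Primrec (conjecture p) := by
  classical
  have hf := primrecPred_isFirst hp
  have he : Primrec fun q : DataSeq × ℕ => q.2.unpair.1 :=
    Primrec.fst.comp (Primrec.unpair.comp .snd)
  have hm : Primrec fun q : DataSeq × ℕ => q.1.length.findGreatest (IsFirst (p q.2.unpair.1)) :=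
    Primrec.nat_findGreatest (p := fun (q : DataSeq × ℕ) m => IsFirst (p q.2.unpair.1) m)
      (Primrec.list_length.comp .fst) (hf.comp (.pair (he.comp .fst) .snd))
  refine Primrec.option_casesOn (g := fun (l : DataSeq) (x : ℕ) => if IsFirst (p x.unpair.1)
      (l.length.findGreatest (IsFirst (p x.unpair.1))) then
        (seqOf (l.length.findGreatest (IsFirst (p x.unpair.1))), []) else ([], [x.unpair.1]))
    (Primrec.list_head?.comp (Primrec.listFilterMap (g := fun _ o => o) .id .snd))
    (.const ([], [])) ?_
  exact Primrec.ite (hf.comp (he.pair hm))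
    (.pair (primrec_ofNat_dataSeq.comp (Primrec.fst.comp (Primrec.unpair.comp hm))) (.const []))
    (.pair (.const []) (Primrec.list_cons.comp he (.const [])))

theorem conjecture_eq_of_no_data {p : ℕ → ℕ → Prop} {l : DataSeq} (h : ¬ ∃ x, some x ∈ l) :
    conjecture p l = ([], []) := by
  have : l.filterMap (fun o => o) = [] := by
    simpa [List.filterMap_eq_nil_iff, Option.eq_none_iff_forall_not_mem] using
      fun o ho x (hx : o = some x) => h ⟨x, hx ▸ ho⟩
  simp [conjecture, this]

theorem conjecture_eq_of_data {p : ℕ → ℕ → Prop} {l : DataSeq} {e : ℕ} (h : ∃ x, some x ∈ l)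
    (hl : l.content ⊆ column e) :
    (∀ m, IsFirst (p e) m → m ≤ l.length → conjecture p l = (seqOf m, [])) ∧
      ((∀ m ≤ l.length, ¬ IsFirst (p e) m) → conjecture p l = ([], [e])) := by
  classical
  obtain ⟨x, hx⟩ : ∃ x, (l.filterMap fun o => o).head? = some x := by
    obtain ⟨y, hy⟩ := h
    rw [← Option.isSome_iff_exists, List.isSome_head?]
    exact List.ne_nil_of_mem (a := y) (by simpa using hy)
  have hxl : some x ∈ l := by simpa using List.mem_of_head? hx
  obtain rfl : x.unpair.1 = e := hl hxl
  simp only [conjecture, hx]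
  constructor
  · intro m hm hml
    have := Nat.findGreatest_spec (P := IsFirst (p x.unpair.1)) hml hm
    rw [if_pos this, this.unique hm]
  · intro hno
    exact if_neg fun h => hno _ (Nat.findGreatest_le _) h

theorem isLanguage_of_mem_firstWitnessClass {p : ℕ → ℕ → Prop} {L : Set ℕ}
    (hL : L ∈ firstWitnessClass p) : IsLanguage L := by
  obtain ⟨e, ⟨-, rfl⟩ | ⟨m, -, rfl⟩⟩ := hL
  · exact PrimrecPred.rePred
      (Primrec.eq.comp (Primrec.fst.comp Primrec.unpair) (Primrec.const e))
  · exact PrimrecPred.rePred (primrecPred_mem_content (.const (seqOf m)) .id)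

/-- The successive conjectures are empty, an infinite column, and a nonempty finite set; being
pairwise different, they allow no return. All data lie in one column, so the first datum reveals
`e`. -/
theorem firstWitnessClass_sDec {φ : ℕ → ℕ →. ℕ} (hφ : IsAcceptable φ) {p : ℕ → ℕ → Prop}
    (hp : PrimrecPred fun q : ℕ × ℕ => p q.1 q.2)
    (hcol : ∀ e m, p e m → (seqOf m).content.Nonempty ∧ (seqOf m).content ⊆ column e) :
    firstWitnessClass p ∈ TxtGLearnable (Restriction.both (SDec φ) (Ex φ)) := by
  obtain ⟨g, hg, hgW⟩ := exists_index hφ (α := DataSeq × List ℕ)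
    (R := fun q => q.1.2 ∈ described q.1.1) (by
      refine (primrecPred_mem_content (Primrec.fst.comp (Primrec.fst.comp .fst))
        (Primrec.snd.comp .fst)).or ?_
      refine (primrecPred_exists_mem
        (R := fun e (q : ((DataSeq × List ℕ) × ℕ) × ℕ) => e = q.1.2.unpair.1)
        (Primrec.snd.comp (Primrec.fst.comp .fst)) ?_).of_eq (by simp)
      exact Primrec.eq.comp .fst (Primrec.fst.comp
        (Primrec.unpair.comp (Primrec.snd.comp (Primrec.fst.comp .snd)))))
  replace hgW : ∀ d, W φ (g d) = described d := fun d => by simpa using hgW d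
  have hempty : W φ (g ([], [])) = ∅ := by simp [hgW, described]
  have hcolumn : ∀ e, W φ (g ([], [e])) = column e := fun e => by simp [hgW, described, column]
  have hseq : ∀ m, W φ (g (seqOf m, [])) = (seqOf m).content := fun m => by
    simp [hgW, described, DataSeq.content]
  refine ⟨((fun l => g (conjecture p l) : DataSeq → ℕ) : DataSeq →. ℕ),
    (hg.comp (primrec_conjecture hp).to_comp).partrec,
    fun L hL => ⟨isLanguage_of_mem_firstWitnessClass hL, fun T hT => ?_⟩⟩
  obtain ⟨e, hLe⟩ := hL
  have hTe : T.content ⊆ column e := by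
    rw [hT]
    rcases hLe with ⟨-, rfl⟩ | ⟨m, hm, rfl⟩
    exacts [subset_rfl, (hcol e m hm.1).2]
  have hdata : ∃ x, x ∈ T.content := by
    rw [hT]
    rcases hLe with ⟨-, rfl⟩ | ⟨m, hm, rfl⟩
    exacts [(column_infinite e).nonempty, (hcol e m hm.1).1]
  have hno : ∀ n, (¬ ∃ x, some x ∈ T.init n) → conjecture p (T.init n) = ([], []) :=
    fun n => conjecture_eq_of_no_data
  have hyes : ∀ n, (∃ x, some x ∈ T.init n) →
      (∀ m, IsFirst (p e) m → m ≤ n → conjecture p (T.init n) = (seqOf m, [])) ∧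
      ((∀ m ≤ n, ¬ IsFirst (p e) m) → conjecture p (T.init n) = ([], [e])) := fun n h => by
    simpa only [Text.length_init] using
      conjecture_eq_of_data (p := p) h ((Text.init_content_subset T n).trans hTe)
  have hmono : ∀ {a b : ℕ}, a ≤ b → (∃ x, some x ∈ T.init a) → ∃ x, some x ∈ T.init b :=
    fun hab ⟨x, hx⟩ => ⟨x, Text.mem_init_mono hab hx⟩
  refine ⟨⟨fun n => g (conjecture p (T.init n)), rfl, fun i j k hij hjk hik => ?_⟩,
    ⟨fun n => g (conjecture p (T.init n)), rfl, ?_⟩⟩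
  · change W φ (g (conjecture p (T.init i))) = W φ (g (conjecture p (T.init k))) at hik
    refine congrArg g (?_ : conjecture p (T.init j) = conjecture p (T.init i))
    have hne : ∀ n, (∃ x, some x ∈ T.init n) → W φ (g (conjecture p (T.init n))) ≠ ∅ := by
      intro n hn
      by_cases hm : ∃ m ≤ n, IsFirst (p e) m
      · obtain ⟨m, hmn, hm⟩ := hm
        rw [(hyes n hn).1 m hm hmn, hseq]
        exact (hcol e m hm.1).1.ne_empty
      · push Not at hm
        rw [(hyes n hn).2 hm, hcolumn]
        exact (column_infinite e).nonempty.ne_empty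
    by_cases hi : ∃ x, some x ∈ T.init i
    · have hj := hmono hij hi
      have hk := hmono hjk hj
      by_cases hm : ∃ m ≤ k, IsFirst (p e) m
      · obtain ⟨m, hmk, hm⟩ := hm
        -- Otherwise the conjecture at `i` is the infinite column and the one at `k` is finite.
        have hmi : m ≤ i := by
          by_contra hmi
          rw [(hyes k hk).1 m hm hmk, (hyes i hi).2 fun m' hm' h' => hmi (h'.unique hm ▸ hm'),
            hseq, hcolumn] at hik
          exact column_infinite e (hik ▸ DataSeq.finite_content _)
        rw [(hyes j hj).1 m hm (hmi.trans hij), (hyes i hi).1 m hm hmi]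
      · push Not at hm
        rw [(hyes j hj).2 fun m h => hm m (h.trans hjk),
          (hyes i hi).2 fun m h => hm m (h.trans (hij.trans hjk))]
    · have hk : ¬ ∃ x, some x ∈ T.init k := fun hk => by
        rw [hno i hi, hempty] at hik
        exact hne k hk hik.symm
      rw [hno i hi, hno j fun hj => hk (hmono hjk hj)]
  · obtain ⟨x, hx⟩ := hdata
    obtain ⟨n₀, hn₀⟩ := Text.exists_mem_init hx
    rcases hLe with ⟨hm, hL⟩ | ⟨m, hm, hL⟩
    · have hc : ∀ n ≥ n₀, conjecture p (T.init n) = ([], [e]) := fun n hn =>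
        (hyes n ⟨x, Text.mem_init_mono hn hn₀⟩).2 fun m _ h => hm m h.1
      exact ⟨n₀, fun n hn => ⟨by simp only [hc n hn, hc n₀ le_rfl],
        by simp only [hc n₀ le_rfl, hcolumn, hT, hL]⟩⟩
    · have hc : ∀ n ≥ max n₀ m, conjecture p (T.init n) = (seqOf m, []) := fun n hn =>
        (hyes n ⟨x, Text.mem_init_mono ((le_max_left _ _).trans hn) hn₀⟩).1 m hm
          ((le_max_right _ _).trans hn)
      exact ⟨max n₀ m, fun n hn => ⟨by simp only [hc n hn, hc _ le_rfl],
        by simp only [hc _ le_rfl, hseq, hT, hL]⟩⟩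

/-- Diagonalization: a code `c` of the supposed learner `h` selects the column on which `h` is
defeated. -/
theorem exists_sDec_not_wMon {φ : ℕ → ℕ →. ℕ} (hφ : IsAcceptable φ) :
    ∃ 𝓛 ∈ TxtGLearnable (Restriction.both (SDec φ) (Ex φ)),
      𝓛 ∉ TxtGLearnable (Restriction.both (WMon φ) (Ex φ)) := by
  have huniv : Partrec fun a : ℕ × DataSeq =>
      (ofNat Nat.Partrec.Code a.1).eval (encode a.2) :=
    Nat.Partrec.Code.eval_part.comp ((Computable.ofNat _).comp .fst) (Computable.encode.comp .snd)
  obtain ⟨F, hF, hFmono, hFspec⟩ := exists_primrec_approx huniv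
  obtain ⟨B, hB, hBmono, hW⟩ := exists_stages hφ.1
  have hWmem : ∀ {v s x}, x ∈ B v s → x ∈ W φ v := fun hx => by
    rw [hW]
    exact Set.mem_iUnion.2 ⟨_, hx⟩
  refine ⟨firstWitnessClass (Overgeneralizes F B), firstWitnessClass_sDec hφ
    (primrecPred_overgeneralizes hF hB) (fun e m hm => ⟨hm.1, hm.2.1⟩), ?_⟩
  rintro ⟨h, hh, hlearn⟩
  obtain ⟨c, hc⟩ := Nat.Partrec.Code.exists_code.1 hh
  have hFh : ∀ σ v, v ∈ h σ ↔ ∃ s, v ∈ F s (encode c, σ) := by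
    intro σ v
    rw [← hFspec]
    simp [hc]
  by_cases hm : ∃ m, Overgeneralizes F B (encode c) m
  · obtain ⟨m, hm⟩ := exists_isFirst hm
    have hL := hlearn ⟨encode c, Or.inr ⟨m, hm, rfl⟩⟩
    obtain ⟨-, -, hy, hs, hσ, hyB⟩ := hm.1
    obtain ⟨v, hv⟩ := Option.isSome_iff_exists.1 hs
    rw [hv, Option.getD_some] at hσ hyB
    -- Pausing forever after the witness sequence gives a text for its finite content.
    have hT : (Text.prepend (seqOf m) fun _ => none).content = (seqOf m).content := by
      rw [Text.content_prepend]
      simp [Text.content]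
    obtain ⟨⟨q, hq, hmon⟩, q', hq', n₀, hn₀⟩ := hL.2 _ hT
    obtain rfl : q = q' := PFun.lift_injective (hq.symm.trans hq')
    have hqv : q (seqOf m).length = v := by
      have h₁ : h (seqOf m) = Part.some (q (seqOf m).length) := by
        have := congrFun hq (seqOf m).length
        rwa [G, Text.init_prepend_length] at this
      have h₂ := (hFh _ _).2 ⟨_, hv⟩
      rw [h₁] at h₂
      exact (Part.mem_some_iff.1 h₂).symm
    -- The `1` makes the index strictly later and `n₀` puts it past convergence; the surplus `y`
    -- would have to survive into the correct final conjecture.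
    have hsub := hmon (seqOf m).length ((seqOf m).length + 1 + n₀) (by omega)
    rw [hqv, (hn₀ _ (Nat.le_add_left _ _)).1, (hn₀ n₀ le_rfl).2, hT] at hsub
    refine hy (hsub (fun x hx => hWmem (hσ x ?_)) (hWmem hyB))
    have := Text.init_content_subset _ _ hx
    rwa [hT] at this
  · have hL := hlearn ⟨encode c, Or.inl ⟨not_exists.1 hm, rfl⟩⟩
    let T : Text := fun n => some (Nat.pair (encode c) n)
    have hT : T.content = column (encode c) := by
      ext x
      constructor
      · rintro ⟨n, hn⟩
        obtain rfl : Nat.pair (encode c) n = x := by simpa [T] using hn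
        simp [column]
      · intro hx
        refine ⟨x.unpair.2, ?_⟩
        have : x.unpair.1 = encode c := hx
        simp [T, ← this]
    obtain ⟨q, hq, n₀, hn₀⟩ := (hL.2 T hT).2
    -- One step past `n₀`, so that the data are nonempty even if `n₀ = 0`. They are the first `n₀ +
    -- 1` elements of the column, and the next element serves as `y`.
    obtain ⟨hqn, hWq⟩ := hn₀ (n₀ + 1) n₀.le_succ
    rw [← hqn, hT, hW] at hWq
    have hmemB : ∀ x ∈ column (encode c), ∃ s, x ∈ B (q (n₀ + 1)) s := fun x hx =>
      Set.mem_iUnion.1 (hWq.symm ▸ hx)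
    have hcol : ∀ n, Nat.pair (encode c) n ∈ column (encode c) := fun n => by simp [column]
    have hinit : ∀ x, some x ∈ T.init (n₀ + 1) → x ∈ column (encode c) := fun x hx =>
      hT ▸ Text.init_content_subset T _ hx
    obtain ⟨s₁, hs₁⟩ := DataSeq.exists_stage (P := fun x s => x ∈ B (q (n₀ + 1)) s)
      (fun x s t hst hx => hBmono _ hst hx) (T.init (n₀ + 1)) fun x hx => hmemB x (hinit x hx)
    obtain ⟨s₂, hs₂⟩ := hmemB _ (hcol (n₀ + 1))
    obtain ⟨s₃, hs₃⟩ := (hFh (T.init (n₀ + 1)) (q (n₀ + 1))).1 (by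
      have : h (T.init (n₀ + 1)) = Part.some (q (n₀ + 1)) := congrFun hq (n₀ + 1)
      simp [this])
    obtain ⟨s, h₁, h₂, h₃⟩ : ∃ s, s₁ ≤ s ∧ s₂ ≤ s ∧ s₃ ≤ s :=
      ⟨s₁ + s₂ + s₃, by omega, by omega, by omega⟩
    have hv : F s (encode c, T.init (n₀ + 1)) = some (q (n₀ + 1)) := hFmono _ _ _ _ h₃ hs₃
    refine hm ⟨Nat.pair (encode (T.init (n₀ + 1)))
      (Nat.pair (Nat.pair (encode c) (n₀ + 1)) s), ?_⟩
    simp only [Overgeneralizes, seqOf, Nat.unpair_pair, ofNat_encode, hv, Option.getD_some,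
      Option.isSome_some, true_and]
    refine ⟨⟨_, Text.mem_init.2 ⟨0, n₀.succ_pos, rfl⟩⟩, hinit, ?_, hs₁ s h₁, hBmono _ h₂ hs₂⟩
    intro hmem
    obtain ⟨i, hi, hin⟩ := Text.mem_init.1 hmem
    simp [T] at hin
    omega

end InductiveInference

theorem mainTheorem12 (φ : ℕ → ℕ →. ℕ) (hφ : InductiveInference.IsAcceptable φ) :
    InductiveInference.TxtGLearnable
        (InductiveInference.Restriction.both
          (InductiveInference.WMon φ) (InductiveInference.Ex φ)) ⊂
      InductiveInference.TxtGLearnable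
        (InductiveInference.Restriction.both
          (InductiveInference.SDec φ) (InductiveInference.Ex φ)) := by
  refine ⟨InductiveInference.wMon_subset_sDec hφ, fun hsub => ?_⟩
  obtain ⟨𝓛, h𝓛, hnot⟩ := InductiveInference.exists_sDec_not_wMon hφ
  exact hnot (hsub h𝓛)
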